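/- \textbf{Theorem.} Let $G=(V,E)$ be a finite directed graph and $\mathcal D$ a finite set of demands; demand $i$ has a source $s_i$ and a target $t_i\neq s_i$ that is reachable from $s_i$ in $G$, and all demands request the same integer bandwidth $d\ge 1$. Each edge $e$ carries constants $c_e\ge 0$ and $\alpha_e\ge 1$. An (unsplittable) routing sends each demand $i$ along a single directed $(s_i,t_i)$-path; its energy is $\sum_{e} c_e f_e^{\alpha_e}$, where $f_e$ is $d$ times the number of demands whose path uses $e$. Let $OPT$ be the minimum energy of a routing, let $\alpha_{\max}=\max_e\alpha_e$, and for real $\alpha\ge 1$ let $\tilde B_\alpha=\sum_{k\ge 0}\frac{k^\alpha e^{-1}}{k!}$. Consider the relaxed convex program $$\min \sum_{e\in E} c_e d^{\alpha_e}\max\{x_e,x_e^{\alpha_e}\},\qquad x_e=\sum_i y_{i,e},\quad y_{i,e}\ge 0,$$ subject, for every demand $i$, to $\sum_{e\in\Gamma^+(u)}y_{i,e}-\sum_{e\in\Gamma^-(u)}y_{i,e}=0$ for $u\ne s_i,t_i$, $\ \sum_{e\in\Gamma^+(s_i)}y_{i,e}=1$, $\ \sum_{e\in\Gamma^-(t_i)}y_{i,e}=1$,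 and $y_{i,e}=0$ for every edge $e$ that enters $s_i$ or leaves $t_i$ (here $\Gamma^+(u)$, $\Gamma^-(u)$ are the edges leaving and entering $u$). Given a solution $y$, the Raghavan--Thompson rounding does the following for each demand $i$: as long as there is an $(s_i,t_i)$-path on edges with $y_{i,e}>0$, take any such path $p$, record $z_{i,p}=\min_{e\in p}y_{i,e}$ and subtract $z_{i,p}$ from $y_{i,e}$ for all $e\in p$; then, independently for the different demands, route $i$ along a recorded path $p$ chosen with probability $z_{i,p}$. Then: (1) The relaxed program has an optimal solution. For every optimal solution $y$ and every choice of the paths in the rounding, each demand records at most $|E|$ paths, their values $z_{i,p}$ are positive with $\sum_p z_{i,p}=1$, and the resulting random routing has expected energy at most $\tilde B_{\alpha_{\max}}\cdot OPT$. So solving the relaxed program and rounding its solution is a (randomized) $\tilde B_{\alpha_{\max}}$-approximation algorithm for min-power routing with uniform demands. (2) Given a feasible solution $y$, the rounding can be carried out (with an explicit graph search for the paths) in a number of elementary operations on real numbers and table entries that is polynomial in $|V|+|E|+|\mathcal D|$; the time for solving the convex program is not included. (3) The ratio improves on the previously known one: for every real $\alpha\ge1$, $\tilde B_\alpha<\gamma(\alpha)=\max\{1+\tau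 2^{\alpha(\tau+1)\log e},\,2+\tau 2^{\alpha(\tau+1)}\}$ with $\tau=\lceil 2\log(\alpha+4)\rceil$ and $\log$ the natural logarithm. -/

import Mathlib

/-- The generalized Bell number `B̃_a = ∑ k ≥ 0, k ^ a e⁻¹ / k!`: the `a`-th moment of a Poisson
random variable of mean `1`. -/
noncomputable def genBell (a : ℝ) : ℝ :=
  ∑' k : ℕ, (k : ℝ) ^ a * Real.exp (-1) / (Nat.factorial k : ℝ)

/-- `τ = ⌈2 log (a + 4)⌉`. -/
noncomputable def previousTau (a : ℝ) : ℝ := (⌈2 * Real.log (a + 4)⌉₊ : ℝ)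

/-- The ratio `γ = max {1 + τ 2 ^ (a (τ + 1) log e), 2 + τ 2 ^ (a (τ + 1))}` known before, with
natural logarithms. -/
noncomputable def previousRatio (a : ℝ) : ℝ :=
  max (1 + previousTau a * (2 : ℝ) ^ (a * (previousTau a + 1) * Real.log (Real.exp 1)))
    (2 + previousTau a * (2 : ℝ) ^ (a * (previousTau a + 1)))

/-- An instance of min-power routing with uniform demands: a directed graph with `n` nodes and `m`
edges (parallel edges and loops are allowed), `r` demands, each of bandwidth `d`, the `i`-th one
from `source i` to `target i`; an edge `e` crossed by `f` units of demand costs `c e * f ^ α e`. -/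
structure RoutingInstance (n m r : ℕ) where
  src : Fin m → Fin n
  dst : Fin m → Fin n
  source : Fin r → Fin n
  target : Fin r → Fin n
  d : ℕ
  c : Fin m → ℝ
  α : Fin m → ℝ
  source_ne_target : ∀ i, source i ≠ target i
  d_pos : 0 < d
  c_nonneg : ∀ e, 0 ≤ c e
  one_le_α : ∀ e, 1 ≤ α e

/-- Results of computations together with the number of elementary steps spent. One step stands for
a bounded number of operations of a real random access machine: arithmetic and comparison of two
real numbers, reading or writing one cell of a table (tables indexed by nodes or edges are
represented by functions), or reading, adding or removing the head of a list. -/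
structure Timed (β : Type) where
  val : β
  steps : ℕ

instance : Monad Timed where
  pure x := ⟨x, 0⟩
  bind x f := ⟨(f x.val).val, x.steps + (f x.val).steps⟩

/-- Spend `k` steps. -/
def Timed.charge (k : ℕ) : Timed Unit := ⟨(), k⟩

namespace RoutingInstance

variable {n m r : ℕ}

/-- `α_max` (the supremum of a finite family; without edges nothing is ever paid). -/
noncomputable def alphaMax (I : RoutingInstance n m r) : ℝ := ⨆ e, I.α e

/-- The list `p` of edges is a directed walk from `u` to `v`. -/
def IsWalk (I : RoutingInstance n m r) : Fin n → List (Fin m) → Fin n → Prop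
  | u, [], v => u = v
  | u, e :: p, v => I.src e = u ∧ I.IsWalk (I.dst e) p v

/-- The list `p` of edges is a directed path from `u` to `v`: a walk without repeated nodes. -/
def IsPath (I : RoutingInstance n m r) (u v : Fin n) (p : List (Fin m)) : Prop :=
  I.IsWalk u p v ∧ (u :: p.map I.dst).Nodup

/-- An unsplittable routing: one path for each demand. -/
def IsRouting (I : RoutingInstance n m r) (P : Fin r → List (Fin m)) : Prop :=
  ∀ i, I.IsPath (I.source i) (I.target i) (P i)

/-- The number of units of demand that cross the edge `e`. -/
def load (I : RoutingInstance n m r) (P : Fin r → List (Fin m)) (e : Fin m) : ℕ :=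
  I.d * (Finset.univ.filter fun i => e ∈ P i).card

/-- The total energy `∑ c_e f_e ^ α_e` of a routing. -/
noncomputable def cost (I : RoutingInstance n m r) (P : Fin r → List (Fin m)) : ℝ :=
  ∑ e, I.c e * (I.load P e : ℝ) ^ I.α e

/-- The flow out of the node `u`. -/
def outflow (I : RoutingInstance n m r) (f : Fin m → ℝ) (u : Fin n) : ℝ :=
  ∑ e ∈ Finset.univ.filter (fun e => I.src e = u), f e

/-- The flow into the node `u`. -/
def inflow (I : RoutingInstance n m r) (f : Fin m → ℝ) (u : Fin n) : ℝ :=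
  ∑ e ∈ Finset.univ.filter (fun e => I.dst e = u), f e

/-- The constraints of the relaxed convex program on `y = (y_{i,e})`: for each demand, `y i` is a
flow of value one from `source i` to `target i`. As usual for such flows, the edges that enter the
source or leave the target of a demand are not available to that demand. -/
structure Feasible (I : RoutingInstance n m r) (y : Fin r → Fin m → ℝ) : Prop where
  nonneg : ∀ i e, 0 ≤ y i e
  conservation : ∀ i u, u ≠ I.source i → u ≠ I.target i →
    I.outflow (y i) u - I.inflow (y i) u = 0
  outflow_source : ∀ i, I.outflow (y i) (I.source i) = 1
  inflow_target : ∀ i, I.inflow (y i) (I.target i) = 1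
  enter_source : ∀ i e, I.dst e = I.source i → y i e = 0
  leave_target : ∀ i e, I.src e = I.target i → y i e = 0

/-- The objective `∑ c_e d ^ α_e max {x_e, x_e ^ α_e}` of the convex program, where
`x_e = ∑ i, y_{i,e}`. -/
noncomputable def objective (I : RoutingInstance n m r) (y : Fin r → Fin m → ℝ) : ℝ :=
  ∑ e, I.c e * (I.d : ℝ) ^ I.α e * max (∑ i, y i e) ((∑ i, y i e) ^ I.α e)

/-- `y` is an optimal solution of the relaxed convex program. -/
def IsOptimal (I : RoutingInstance n m r) (y : Fin r → Fin m → ℝ) : Prop :=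
  I.Feasible y ∧ ∀ y', I.Feasible y' → I.objective y ≤ I.objective y'

/-- Subtract `z` on the edges of `p`. -/
def subtractAlong (f : Fin m → ℝ) (p : List (Fin m)) (z : ℝ) : Fin m → ℝ :=
  fun e => if e ∈ p then f e - z else f e

/-- `l` lists the pairs `(p, z_p)` produced by some run of the flow decomposition of `f`: as long as
there is a path from `a` to `b` on edges of positive value, take any such path `p`, record it with
`z_p = min {f e | e ∈ p}`, and subtract `z_p` on its edges. -/
inductive IsDecomposition (I : RoutingInstance n m r) (a b : Fin n) :
    (Fin m → ℝ) → List (List (Fin m) × ℝ) → Prop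
  | done (f : Fin m → ℝ)
      (h : ¬ ∃ p, I.IsPath a b p ∧ ∀ e ∈ p, 0 < f e) : IsDecomposition I a b f []
  | step (f : Fin m → ℝ) (p : List (Fin m)) (z : ℝ) (l : List (List (Fin m) × ℝ))
      (hp : I.IsPath a b p) (hpos : ∀ e ∈ p, 0 < f e)
      (hz : IsLeast (f '' {e | e ∈ p}) z)
      (hl : IsDecomposition I a b (subtractAlong f p z) l) :
      IsDecomposition I a b f ((p, z) :: l)

/-- The expected energy when each demand `i`, independently of the others, is routed on the path `p`
with probability `z` for each entry `(p, z)` of `l i`. -/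
noncomputable def expectedCost (I : RoutingInstance n m r)
    (l : Fin r → List (List (Fin m) × ℝ)) : ℝ :=
  ∑ k : (i : Fin r) → Fin (l i).length,
    (∏ i, ((l i).get (k i)).2) * I.cost (fun i => ((l i).get (k i)).1)

/-- Graph search, one edge: if `e` has positive value, its tail is labelled and its head is not,
label the head by the extended path. Labels are paths from the start node, last edge first. -/
noncomputable def relaxEdge (I : RoutingInstance n m r) (f : Fin m → ℝ)
    (L : Fin n → Option (List (Fin m))) (e : Fin m) : Timed (Fin n → Option (List (Fin m))) := do
  Timed.charge 1
  match L (I.src e), L (I.dst e) with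
  | some p, none =>
      if 0 < f e then pure (Function.update L (I.dst e) (some (e :: p))) else pure L
  | _, _ => pure L

/-- `k` passes over all edges. -/
noncomputable def sweeps (I : RoutingInstance n m r) (f : Fin m → ℝ) :
    ℕ → (Fin n → Option (List (Fin m))) → Timed (Fin n → Option (List (Fin m)))
  | 0, L => pure L
  | k + 1, L => do
      let L' ← (List.finRange m).foldlM (I.relaxEdge f) L
      I.sweeps f k L'

/-- Search for a path from `a` to `b` on edges of positive value. -/
noncomputable def findPath (I : RoutingInstance n m r) (a b : Fin n) (f : Fin m → ℝ) :
    Timed (Option (List (Fin m))) := do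
  Timed.charge (n + 1)
  let L ← I.sweeps f n (fun v => if v = a then some [] else none)
  match L b with
  | none => pure none
  | some p => do
      Timed.charge p.length
      pure (some p.reverse)

/-- The flow decomposition as a program, with at most `k` rounds. -/
noncomputable def decompose (I : RoutingInstance n m r) (a b : Fin n) :
    ℕ → (Fin m → ℝ) → Timed (List (List (Fin m) × ℝ))
  | 0, _ => pure []
  | k + 1, f => do
      let q ← I.findPath a b f
      match q with
      | none => pure []
      | some p => do
          Timed.charge p.length
          let z := (p.map f).min?.getD 0
          Timed.charge p.length
          let l ← I.decompose a b k (subtractAlong f p z)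
          Timed.charge 1
          pure ((p, z) :: l)

/-- The list of paths and probabilities that the rounding of `y` computes for the demand `i`. -/
noncomputable def pathTable (I : RoutingInstance n m r) (y : Fin r → Fin m → ℝ) (i : Fin r) :
    Timed (List (List (Fin m) × ℝ)) :=
  I.decompose (I.source i) (I.target i) (m + 1) (y i)

/-- The number of steps of the whole rounding of `y`: for each demand the flow decomposition, and
then one random draw of a path from the list by a scan of the probabilities. -/
noncomputable def roundingSteps (I : RoutingInstance n m r) (y : Fin r → Fin m → ℝ) : ℕ :=
  ∑ i, ((I.pathTable y i).steps + ((I.pathTable y i).val.length + 1))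

end RoutingInstance

/-! Under the rounding, the number of demands crossing an edge `e` is a sum of independent
indicators whose mean `l` is at most `x_e`. Since `k ↦ k ^ α` is convex, its mean only grows when
the sum is replaced by a Poisson variable of mean `l` (`sum_bernoulli_le_poissonMean`). The Poisson
moment is at most `B̃_α max {l, l ^ α}` (`poissonMean_rpow_le`), which is the shape of the relaxed
objective, so linearity over the edges bounds the expected energy by `B̃_{α_max}` times the relaxed
optimum. At the 0/1 flow of a routing the relaxed objective equals the energy, because `N ≤ N ^ α`
for natural `N`; hence the optimum is at most `OPT`.

The combinatorial side rests on flow decomposition. Each round empties a bottleneck edge, so there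
are at most `m` rounds; what remains has no path of positive edges, so by a cut argument it has
value zero and the recorded values add up to one. The remainder may be a nonzero circulation.
Dropping it never increases the objective and puts all values in `[0, 1]`, so compactness yields an
optimum.

For the comparison of ratios, `k ^ a ≤ a ^ a e ^ (k - a)` gives `B̃_a ≤ 2.72 a ^ a`, while `a ≤ 2 ^
(τ + 1)` and `τ ≥ 3`. -/

/-! ### Poisson means of sequences of exponential growth -/

/-- The weight `e^{-l} l ^ k / k!` of `k` under the Poisson distribution of mean `l`. -/
noncomputable def poissonWeight (l : ℝ) (k : ℕ) : ℝ :=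
  Real.exp (-l) * l ^ k / (Nat.factorial k : ℝ)

/-- The mean of `g` under the Poisson distribution of mean `l`. -/
noncomputable def poissonMean (l : ℝ) (g : ℕ → ℝ) : ℝ := ∑' k, poissonWeight l k * g k

/-- Sequences of at most exponential growth; they are integrable for all Poisson distributions. -/
def ExpBounded (g : ℕ → ℝ) : Prop := ∃ C, ∀ k, |g k| ≤ C * Real.exp k

theorem poissonWeight_nonneg {l : ℝ} (hl : 0 ≤ l) (k : ℕ) : 0 ≤ poissonWeight l k := by
  unfold poissonWeight; positivity

theorem poissonWeight_succ (l : ℝ) (k : ℕ) :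
    poissonWeight l (k + 1) * ((k : ℝ) + 1) = l * poissonWeight l k := by
  unfold poissonWeight
  rw [Nat.factorial_succ]
  push_cast
  have : (Nat.factorial k : ℝ) ≠ 0 := by positivity
  have : (k : ℝ) + 1 ≠ 0 := by positivity
  field_simp
  ring

theorem hasSum_pow_div_factorial (x : ℝ) :
    HasSum (fun k : ℕ => x ^ k / (Nat.factorial k : ℝ)) (Real.exp x) := by
  rw [Real.exp_eq_exp_ℝ]
  exact NormedSpace.expSeries_div_hasSum_exp x

theorem hasSum_poissonWeight_mul_exp (l : ℝ) :
    HasSum (fun k : ℕ => poissonWeight l k * Real.exp k)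
      (Real.exp (-l) * Real.exp (l * Real.exp 1)) := by
  refine ((hasSum_pow_div_factorial (l * Real.exp 1)).mul_left (Real.exp (-l))).congr_fun ?_
  intro k
  have : Real.exp (k : ℝ) = Real.exp 1 ^ k := by rw [← Real.exp_nat_mul, mul_one]
  simp only [poissonWeight, this, mul_pow]
  ring

theorem hasSum_poissonWeight (l : ℝ) : HasSum (poissonWeight l) 1 := by
  have := (hasSum_pow_div_factorial l).mul_left (Real.exp (-l))
  rw [← Real.exp_add, neg_add_cancel, Real.exp_zero] at this
  refine this.congr_fun fun k => ?_
  simp only [poissonWeight]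
  ring

namespace ExpBounded

theorem summable {g : ℕ → ℝ} (hg : ExpBounded g) {l : ℝ} (hl : 0 ≤ l) :
    Summable fun k => poissonWeight l k * g k := by
  obtain ⟨C, hC⟩ := hg
  refine Summable.of_norm_bounded (((hasSum_poissonWeight_mul_exp l).summable).mul_left C) ?_
  intro k
  rw [Real.norm_eq_abs, abs_mul, abs_of_nonneg (poissonWeight_nonneg hl k)]
  have := mul_le_mul_of_nonneg_left (hC k) (poissonWeight_nonneg hl k)
  linarith

theorem shift {g : ℕ → ℝ} (hg : ExpBounded g) (j : ℕ) : ExpBounded fun k => g (j + k) := by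
  obtain ⟨C, hC⟩ := hg
  refine ⟨C * Real.exp j, fun k => (hC _).trans (le_of_eq ?_)⟩
  push_cast
  rw [Real.exp_add]
  ring

theorem const (c : ℝ) : ExpBounded fun _ => c :=
  ⟨|c|, fun k => le_mul_of_one_le_right (abs_nonneg c) (Real.one_le_exp k.cast_nonneg)⟩

theorem id_cast : ExpBounded fun k => (k : ℝ) :=
  ⟨1, fun k => by
    rw [abs_of_nonneg k.cast_nonneg, one_mul]
    linarith [Real.add_one_le_exp (k : ℝ)]⟩

theorem add {f g : ℕ → ℝ} (hf : ExpBounded f) (hg : ExpBounded g) :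
    ExpBounded fun k => f k + g k := by
  obtain ⟨C, hC⟩ := hf
  obtain ⟨D, hD⟩ := hg
  exact ⟨C + D, fun k => (abs_add_le _ _).trans (by linarith [hC k, hD k])⟩

theorem mul_const {f : ℕ → ℝ} (hf : ExpBounded f) (c : ℝ) : ExpBounded fun k => f k * c := by
  obtain ⟨C, hC⟩ := hf
  refine ⟨C * |c|, fun k => ?_⟩
  rw [abs_mul]
  have := mul_le_mul_of_nonneg_right (hC k) (abs_nonneg c)
  linarith

end ExpBounded

/-- `k ^ a ≤ a ^ a e ^ (k - a)`. -/
theorem natCast_rpow_le {a : ℝ} (ha : 0 < a) (k : ℕ) :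
    (k : ℝ) ^ a ≤ a ^ a * Real.exp (-a) * Real.exp k := by
  -- This is `x ≤ e ^ (x - 1)` at `x = k / a`; raising it to the power `a` gives the claim.
  have h1 : (k : ℝ) / a ≤ Real.exp (k / a - 1) := by
    linarith [Real.add_one_le_exp ((k : ℝ) / a - 1)]
  have h2 : (k : ℝ) ≤ a * Real.exp (k / a - 1) := by
    rw [div_le_iff₀ ha] at h1
    linarith
  calc (k : ℝ) ^ a ≤ (a * Real.exp (k / a - 1)) ^ a :=
        Real.rpow_le_rpow k.cast_nonneg h2 ha.le
    _ = a ^ a * Real.exp (-a) * Real.exp k := by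
        rw [Real.mul_rpow ha.le (Real.exp_pos _).le, ← Real.exp_mul, mul_assoc, ← Real.exp_add]
        congr 2
        field_simp
        ring

theorem expBounded_rpow {a : ℝ} (ha : 0 ≤ a) : ExpBounded fun k => (k : ℝ) ^ a := by
  rcases ha.eq_or_lt with rfl | ha
  · simpa using ExpBounded.const 1
  · refine ⟨a ^ a * Real.exp (-a), fun k => ?_⟩
    rw [abs_of_nonneg (by positivity)]
    exact natCast_rpow_le ha k

theorem poissonMean_const (l c : ℝ) : poissonMean l (fun _ => c) = c := by
  unfold poissonMean
  simpa using ((hasSum_poissonWeight l).mul_right c).tsum_eq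

theorem poissonMean_add {f g : ℕ → ℝ} (hf : ExpBounded f) (hg : ExpBounded g) {l : ℝ}
    (hl : 0 ≤ l) : poissonMean l (fun k => f k + g k) = poissonMean l f + poissonMean l g := by
  unfold poissonMean
  rw [← (hf.summable hl).tsum_add (hg.summable hl)]
  simp_rw [mul_add]

theorem poissonMean_mul_const (g : ℕ → ℝ) (l c : ℝ) :
    poissonMean l (fun k => g k * c) = poissonMean l g * c := by
  unfold poissonMean
  rw [← tsum_mul_right]
  simp_rw [mul_assoc]

theorem poissonMean_mono {f g : ℕ → ℝ} (hf : ExpBounded f) (hg : ExpBounded g) {l : ℝ}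
    (hl : 0 ≤ l) (h : ∀ k, f k ≤ g k) : poissonMean l f ≤ poissonMean l g :=
  (hf.summable hl).tsum_le_tsum
    (fun k => mul_le_mul_of_nonneg_left (h k) (poissonWeight_nonneg hl k)) (hg.summable hl)

/-- Size biasing. -/
theorem poissonMean_natCast_mul {g : ℕ → ℝ} (hg : ExpBounded fun k => (k : ℝ) * g k) {l : ℝ}
    (hl : 0 ≤ l) :
    poissonMean l (fun k => (k : ℝ) * g k) = l * poissonMean l (fun k => g (k + 1)) := by
  unfold poissonMean
  rw [(hg.summable hl).tsum_eq_zero_add, ← tsum_mul_left]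
  simp only [Nat.cast_zero, zero_mul, mul_zero, zero_add]
  refine tsum_congr fun k => ?_
  rw [← mul_assoc, ← mul_assoc, ← poissonWeight_succ]
  push_cast
  ring

theorem poissonMean_natCast {l : ℝ} (hl : 0 ≤ l) : poissonMean l (fun k => (k : ℝ)) = l := by
  have := poissonMean_natCast_mul (g := fun _ => 1) (by simpa using ExpBounded.id_cast) hl
  simpa [poissonMean_const] using this

theorem abs_poissonMean_le {g : ℕ → ℝ} {l C : ℝ} (hl : 0 ≤ l)
    (hC : ∀ k, |g k| ≤ C * Real.exp k) :
    |poissonMean l g| ≤ C * (Real.exp (-l) * Real.exp (l * Real.exp 1)) := by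
  have := (hasSum_poissonWeight_mul_exp l).mul_left C
  refine tsum_of_norm_bounded (f := fun k => poissonWeight l k * g k) this fun k => ?_
  rw [Real.norm_eq_abs, abs_mul, abs_of_nonneg (poissonWeight_nonneg hl k)]
  have := mul_le_mul_of_nonneg_left (hC k) (poissonWeight_nonneg hl k)
  linarith

theorem ExpBounded.poissonMean_shift {g : ℕ → ℝ} (hg : ExpBounded g) {l : ℝ} (hl : 0 ≤ l) :
    ExpBounded fun j => poissonMean l fun k => g (j + k) := by
  obtain ⟨C, hC⟩ := hg
  refine ⟨C * (Real.exp (-l) * Real.exp (l * Real.exp 1)), fun j => ?_⟩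
  refine (abs_poissonMean_le (C := C * Real.exp j) hl fun k => (hC _).trans (le_of_eq ?_)).trans
    (le_of_eq (by ring))
  push_cast
  rw [Real.exp_add]
  ring

/-! ### Sums of two independent Poisson variables -/

/-- The binomial theorem for `(l + m) ^ n`, divided by `n!`. -/
theorem sum_antidiagonal_poissonWeight (l m : ℝ) (n : ℕ) :
    ∑ p ∈ Finset.HasAntidiagonal.antidiagonal n, poissonWeight l p.1 * poissonWeight m p.2 =
      poissonWeight (l + m) n := by
  unfold poissonWeight
  rw [(Commute.all l m).add_pow', Finset.mul_sum, Finset.sum_div]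
  refine Finset.sum_congr rfl fun p hp => ?_
  rw [← Finset.HasAntidiagonal.mem_antidiagonal.1 hp, neg_add, Real.exp_add, nsmul_eq_mul,
    Nat.cast_add_choose]
  have : (Nat.factorial p.1 : ℝ) ≠ 0 := by positivity
  have : (Nat.factorial p.2 : ℝ) ≠ 0 := by positivity
  have : (Nat.factorial (p.1 + p.2) : ℝ) ≠ 0 := by positivity
  field_simp

/-- The first of two independent Poisson variables has conditional mean `n l / (l + m)` given that
they add up to `n`. -/
theorem sum_antidiagonal_poissonWeight_mul_fst (l m : ℝ) (n : ℕ) :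
    (l + m) * ∑ p ∈ Finset.HasAntidiagonal.antidiagonal n,
      poissonWeight l p.1 * poissonWeight m p.2 * (p.1 : ℝ) =
      l * (poissonWeight (l + m) n * n) := by
  cases n with
  | zero => simp
  | succ n =>
    rw [Finset.Nat.sum_antidiagonal_succ]
    have : ∀ p ∈ Finset.HasAntidiagonal.antidiagonal n,
        poissonWeight l (p.1 + 1) * poissonWeight m p.2 * ((p.1 + 1 : ℕ) : ℝ) =
          l * (poissonWeight l p.1 * poissonWeight m p.2) := by
      intro p _
      push_cast
      linear_combination poissonWeight m p.2 * poissonWeight_succ l p.1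
    rw [Finset.sum_congr rfl this, ← Finset.mul_sum, sum_antidiagonal_poissonWeight]
    push_cast
    rw [poissonWeight_succ]
    ring

/-- Domination by the product of two convergent exponential moments; this licenses regrouping the
double series along antidiagonals. -/
theorem summable_poissonWeight_prod {l m : ℝ} (hl : 0 ≤ l) (hm : 0 ≤ m) {G : ℕ × ℕ → ℝ} {C : ℝ}
    (hG : ∀ p, |G p| ≤ C * (Real.exp p.1 * Real.exp p.2)) :
    Summable fun p : ℕ × ℕ => poissonWeight l p.1 * poissonWeight m p.2 * G p := by
  have h := Summable.mul_of_nonneg (hasSum_poissonWeight_mul_exp l).summable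
    (hasSum_poissonWeight_mul_exp m).summable
    (fun k => mul_nonneg (poissonWeight_nonneg hl k) (Real.exp_pos _).le)
    (fun k => mul_nonneg (poissonWeight_nonneg hm k) (Real.exp_pos _).le)
  refine Summable.of_norm_bounded (h.mul_left C) fun p => ?_
  have h0 := mul_nonneg (poissonWeight_nonneg hl p.1) (poissonWeight_nonneg hm p.2)
  rw [Real.norm_eq_abs, abs_mul, abs_of_nonneg h0]
  have := mul_le_mul_of_nonneg_left (hG p) h0
  linarith

/-- The sum of two independent Poisson variables, in the form of an iterated mean. -/
theorem hasSum_antidiagonal_poissonMean {l m : ℝ} (hl : 0 ≤ l) (hm : 0 ≤ m) {G : ℕ × ℕ → ℝ}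
    {C : ℝ} (hG : ∀ p, |G p| ≤ C * (Real.exp p.1 * Real.exp p.2)) :
    HasSum (fun n => ∑ p ∈ Finset.HasAntidiagonal.antidiagonal n,
        poissonWeight l p.1 * poissonWeight m p.2 * G p)
      (poissonMean l fun j => poissonMean m fun k => G (j, k)) := by
  have hs := summable_poissonWeight_prod hl hm hG
  have heq : poissonMean l (fun j => poissonMean m fun k => G (j, k)) =
      ∑' p : ℕ × ℕ, poissonWeight l p.1 * poissonWeight m p.2 * G p := by
    rw [hs.tsum_prod]
    unfold poissonMean
    refine tsum_congr fun j => ?_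
    rw [← tsum_mul_left]
    simp_rw [mul_assoc]
  rw [heq]
  have h2 := (Finset.HasAntidiagonal.sigmaAntidiagonalEquivProd (A := ℕ)).hasSum_iff.2 hs.hasSum
  refine (h2.sigma fun n => hasSum_fintype _).congr_fun fun n => ?_
  rw [← Finset.sum_coe_sort]
  rfl

theorem poissonMean_poissonMean_shift {g : ℕ → ℝ} (hg : ExpBounded g) {l m : ℝ} (hl : 0 ≤ l)
    (hm : 0 ≤ m) :
    poissonMean l (fun j => poissonMean m fun k => g (j + k)) = poissonMean (l + m) g := by
  obtain ⟨C, hC⟩ := hg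
  have := hasSum_antidiagonal_poissonMean hl hm (G := fun p => g (p.1 + p.2)) (C := C) fun p =>
    (hC _).trans (le_of_eq (by push_cast; rw [Real.exp_add]))
  rw [← this.tsum_eq]
  unfold poissonMean
  refine tsum_congr fun n => ?_
  rw [← sum_antidiagonal_poissonWeight, Finset.sum_mul]
  refine Finset.sum_congr rfl fun p hp => ?_
  rw [Finset.HasAntidiagonal.mem_antidiagonal.1 hp]

/-- Coupling: a Poisson variable of mean `m` is one of mean `l` plus an independent nonnegative one
of mean `m - l`. -/
theorem poissonMean_mono_left {g : ℕ → ℝ} (hg : ExpBounded g) (hmono : Monotone g) {l m : ℝ}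
    (hl : 0 ≤ l) (hlm : l ≤ m) : poissonMean l g ≤ poissonMean m g := by
  have hd : 0 ≤ m - l := sub_nonneg.2 hlm
  have h := poissonMean_poissonMean_shift hg hl hd
  rw [add_sub_cancel] at h
  rw [← h]
  refine poissonMean_mono hg (hg.poissonMean_shift hd) hl fun j => ?_
  rw [← poissonMean_const (m - l) (g j)]
  exact poissonMean_mono (ExpBounded.const _) (hg.shift j) hd fun k => hmono (Nat.le_add_right j k)

/-! ### Generalized Bell numbers and Poisson moments -/

theorem genBell_eq_poissonMean (a : ℝ) : genBell a = poissonMean 1 fun k => (k : ℝ) ^ a := by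
  unfold genBell poissonMean poissonWeight
  refine tsum_congr fun k => ?_
  rw [one_pow]
  ring

theorem genBell_nonneg (a : ℝ) : 0 ≤ genBell a :=
  tsum_nonneg fun k => by positivity

theorem genBell_mono {a b : ℝ} (ha : 0 < a) (hab : a ≤ b) : genBell a ≤ genBell b := by
  rw [genBell_eq_poissonMean, genBell_eq_poissonMean]
  refine poissonMean_mono (expBounded_rpow ha.le) (expBounded_rpow (ha.le.trans hab)) zero_le_one
    fun k => ?_
  rcases Nat.eq_zero_or_pos k with rfl | hk
  · simp [Real.zero_rpow ha.ne', Real.zero_rpow (ha.trans_le hab).ne']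
  · exact Real.rpow_le_rpow_of_exponent_le (by exact_mod_cast hk) hab

/-- Size biasing turns the `a`-th moment into `l` times the mean of `(k + 1) ^ (a - 1)`, which
increases with `l` and at `l = 1` is the Bell number. -/
theorem poissonMean_rpow_le_of_le_one {a l : ℝ} (ha : 1 ≤ a) (hl : 0 ≤ l) (hl1 : l ≤ 1) :
    poissonMean l (fun k => (k : ℝ) ^ a) ≤ genBell a * l := by
  have hfun : (fun k : ℕ => (k : ℝ) ^ a) = fun k : ℕ => (k : ℝ) * (k : ℝ) ^ (a - 1) := by
    funext k
    -- For `a = 1` the second factor at `k = 0` is `0 ^ 0 = 1`, but the factor `k` removes it.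
    rcases Nat.eq_zero_or_pos k with rfl | hk
    · simp [Real.zero_rpow (by linarith : a ≠ 0)]
    · have : (0 : ℝ) < k := by exact_mod_cast hk
      rw [Real.rpow_sub_one this.ne']
      field_simp
  have hb : ExpBounded fun k : ℕ => (k : ℝ) * (k : ℝ) ^ (a - 1) :=
    hfun ▸ expBounded_rpow (by linarith)
  have hb' : ExpBounded fun k : ℕ => ((k + 1 : ℕ) : ℝ) ^ (a - 1) := by
    simpa only [add_comm] using (expBounded_rpow (a := a - 1) (by linarith)).shift 1
  rw [genBell_eq_poissonMean, hfun, poissonMean_natCast_mul hb hl,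
    poissonMean_natCast_mul hb zero_le_one, one_mul, mul_comm]
  refine mul_le_mul_of_nonneg_right (poissonMean_mono_left hb' ?_ hl hl1) hl
  intro i j hij
  exact Real.rpow_le_rpow (by positivity) (by exact_mod_cast Nat.succ_le_succ hij) (by linarith)

/-- Split a Poisson variable `N` of mean `l` as `J + K`, with `J` of mean one. Given `N = n`, `J`
has mean `n / l`, so Jensen gives `(n / l) ^ a ≤ E[J ^ a | N = n]`. Averaging over `n` bounds `E[N ^
a]` by `l ^ a E[J ^ a]`. -/
theorem poissonMean_rpow_le_of_one_le {a l : ℝ} (ha : 1 ≤ a) (hl : 1 ≤ l) :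
    poissonMean l (fun k => (k : ℝ) ^ a) ≤ genBell a * l ^ a := by
  have hd : 0 ≤ l - 1 := sub_nonneg.2 hl
  have hl0 : 0 < l := by linarith
  obtain ⟨C, hC⟩ := expBounded_rpow (a := a) (by linarith)
  have hC0 : 0 ≤ C := by
    have := (abs_nonneg _).trans (hC 0)
    simpa using this
  have h := hasSum_antidiagonal_poissonMean zero_le_one hd (G := fun p => (p.1 : ℝ) ^ a) (C := C)
    fun p => (hC p.1).trans (mul_le_mul_of_nonneg_left
      (le_mul_of_one_le_right (Real.exp_pos _).le (Real.one_le_exp p.2.cast_nonneg)) hC0)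
  simp only [poissonMean_const] at h
  rw [← genBell_eq_poissonMean] at h
  have h2 := h.mul_right (l ^ a)
  refine hasSum_le (fun n => ?_)
    ((expBounded_rpow (a := a) (by linarith)).summable hl0.le).hasSum h2
  have hw := sum_antidiagonal_poissonWeight 1 (l - 1) n
  have hm := sum_antidiagonal_poissonWeight_mul_fst 1 (l - 1) n
  rw [add_sub_cancel] at hw hm
  have hwpos : 0 < poissonWeight l n := by unfold poissonWeight; positivity
  have hnn : ∀ p : ℕ × ℕ, 0 ≤ poissonWeight 1 p.1 * poissonWeight (l - 1) p.2 := fun p =>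
    mul_nonneg (poissonWeight_nonneg zero_le_one _) (poissonWeight_nonneg hd _)
  -- Jensen for the conditional law of `J` given `N = n`.
  have hJ := Real.rpow_arith_mean_le_arith_mean_rpow (Finset.HasAntidiagonal.antidiagonal n)
    (fun p => poissonWeight 1 p.1 * poissonWeight (l - 1) p.2 / poissonWeight l n)
    (fun p => (p.1 : ℝ)) (fun p _ => div_nonneg (hnn p) hwpos.le)
    (by rw [← Finset.sum_div, hw, div_self hwpos.ne']) (fun p _ => p.1.cast_nonneg) ha
  have hmean : ∑ p ∈ Finset.HasAntidiagonal.antidiagonal n,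
      poissonWeight 1 p.1 * poissonWeight (l - 1) p.2 / poissonWeight l n * (p.1 : ℝ) = n / l := by
    simp_rw [div_mul_eq_mul_div]
    rw [← Finset.sum_div, div_eq_div_iff hwpos.ne' hl0.ne']
    linarith
  rw [hmean, Real.div_rpow n.cast_nonneg hl0.le] at hJ
  simp_rw [div_mul_eq_mul_div] at hJ
  rw [← Finset.sum_div, div_le_div_iff₀ (by positivity) hwpos] at hJ
  linarith

theorem poissonMean_rpow_le {a l : ℝ} (ha : 1 ≤ a) (hl : 0 ≤ l) :
    poissonMean l (fun k => (k : ℝ) ^ a) ≤ genBell a * max l (l ^ a) := by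
  rcases le_total l 1 with h | h
  · exact (poissonMean_rpow_le_of_le_one ha hl h).trans
      (mul_le_mul_of_nonneg_left (le_max_left _ _) (genBell_nonneg a))
  · exact (poissonMean_rpow_le_of_one_le ha h).trans
      (mul_le_mul_of_nonneg_left (le_max_right _ _) (genBell_nonneg a))

/-! ### Convex order: sums of indicators against Poisson variables -/

/-- A sequence with increasing increments lies above its first chord. -/
theorem chord_le_of_convex {g : ℕ → ℝ} (hconv : ∀ k, g (k + 1) - g k ≤ g (k + 2) - g (k + 1))
    (k : ℕ) : g 0 + k * (g 1 - g 0) ≤ g k := by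
  have hinc : ∀ k, g 1 - g 0 ≤ g (k + 1) - g k := by
    intro k
    induction k with
    | zero => exact le_rfl
    | succ k ih => exact ih.trans (hconv k)
  induction k with
  | zero => simp
  | succ k ih =>
    push_cast
    linarith [hinc k]

/-- A Bernoulli variable is smaller in the convex order than the Poisson variable of equal mean. -/
theorem bernoulli_le_poissonMean {g : ℕ → ℝ} (hg : ExpBounded g)
    (hconv : ∀ k, g (k + 1) - g k ≤ g (k + 2) - g (k + 1)) {p : ℝ} (hp : 0 ≤ p) :
    (1 - p) * g 0 + p * g 1 ≤ poissonMean p g := by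
  have hb := ExpBounded.id_cast.mul_const (g 1 - g 0)
  refine le_trans (le_of_eq ?_)
    (poissonMean_mono ((ExpBounded.const (g 0)).add hb) hg hp (chord_le_of_convex hconv))
  rw [poissonMean_add (ExpBounded.const _) hb hp, poissonMean_const, poissonMean_mul_const,
    poissonMean_natCast hp]
  ring

/-- A sum of independent Bernoulli variables is smaller in the convex order than the Poisson
variable of equal mean. -/
theorem sum_bernoulli_le_poissonMean (r : ℕ) (κ : Fin r → Type) [∀ i, Fintype (κ i)]
    (v : ∀ i, κ i → ℝ) (b : ∀ i, κ i → ℕ) (hv : ∀ i x, 0 ≤ v i x) (hv1 : ∀ i, ∑ x, v i x = 1)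
    (hb : ∀ i x, b i x = 0 ∨ b i x = 1) {g : ℕ → ℝ} (hg : ExpBounded g)
    (hconv : ∀ k, g (k + 1) - g k ≤ g (k + 2) - g (k + 1)) :
    ∑ k : (∀ i, κ i), (∏ i, v i (k i)) * g (∑ i, b i (k i)) ≤
      poissonMean (∑ i, ∑ x, v i x * b i x) g := by
  induction r generalizing g with
  | zero =>
    have h0 : poissonMean 0 g = g 0 := by
      unfold poissonMean
      rw [tsum_eq_single 0]
      · simp [poissonWeight]
      · intro k hk
        simp [poissonWeight, hk]
    simp [h0]
  | succ r ih =>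
    set l := ∑ i : Fin r, ∑ x, v i.succ x * b i.succ x with hl
    set p := ∑ x, v 0 x * b 0 x with hp
    have hl0 : 0 ≤ l := Finset.sum_nonneg fun i _ => Finset.sum_nonneg fun x _ =>
      mul_nonneg (hv _ _) (Nat.cast_nonneg _)
    have hp0 : 0 ≤ p := Finset.sum_nonneg fun x _ => mul_nonneg (hv _ _) (Nat.cast_nonneg _)
    -- The value `h j` is the mean once the first variable equals `j` and all the others are
    -- replaced by one Poisson variable of their total mean.
    set h : ℕ → ℝ := fun j => poissonMean l fun k => g (j + k) with hh
    have hstep : ∑ k : (∀ i, κ i), (∏ i, v i (k i)) * g (∑ i, b i (k i)) ≤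
        ∑ x, v 0 x * h (b 0 x) := by
      rw [← (Fin.consEquiv κ).sum_comp, Fintype.sum_prod_type]
      refine Finset.sum_le_sum fun x _ => ?_
      have := ih (fun i => κ i.succ) (fun i => v i.succ) (fun i => b i.succ)
        (fun i => hv i.succ) (fun i => hv1 i.succ) (fun i => hb i.succ) (hg.shift (b 0 x))
        (fun k => by simpa only [add_assoc] using hconv (b 0 x + k))
      refine le_trans (le_of_eq ?_) (mul_le_mul_of_nonneg_left this (hv 0 x))
      rw [Finset.mul_sum]
      refine Finset.sum_congr rfl fun k _ => ?_
      rw [Fin.prod_univ_succ, Fin.sum_univ_succ, mul_assoc]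
      rfl
    have hbern : ∑ x, v 0 x * h (b 0 x) = (1 - p) * h 0 + p * h 1 := by
      have : ∀ x, v 0 x * h (b 0 x) = v 0 x * h 0 + v 0 x * b 0 x * (h 1 - h 0) := by
        intro x
        rcases hb 0 x with e | e <;> rw [e] <;> push_cast <;> ring
      simp_rw [this]
      rw [Finset.sum_add_distrib, ← Finset.sum_mul, ← Finset.sum_mul, hv1 0, ← hp]
      ring
    have hhconv : ∀ k, h (k + 1) - h k ≤ h (k + 2) - h (k + 1) := by
      intro k
      -- Convexity passes to `h` by averaging; the increments are rearranged into sums so that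
      -- additivity of the mean applies.
      have := poissonMean_mono ((hg.shift (k + 1)).add (hg.shift (k + 1)))
        ((hg.shift k).add (hg.shift (k + 2))) hl0 (fun j => by
          have := hconv (k + j)
          rw [show k + j + 1 = k + 1 + j by ring, show k + j + 2 = k + 2 + j by ring] at this
          linarith)
      rw [poissonMean_add (hg.shift _) (hg.shift _) hl0,
        poissonMean_add (hg.shift _) (hg.shift _) hl0] at this
      simp only [hh]
      linarith
    calc _ ≤ (1 - p) * h 0 + p * h 1 := hstep.trans hbern.le
      _ ≤ poissonMean p h := bernoulli_le_poissonMean (hg.poissonMean_shift hl0) hhconv hp0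
      _ = poissonMean (p + l) g := poissonMean_poissonMean_shift hg hp0 hl0
      _ = _ := by rw [Fin.sum_univ_succ]

theorem rpow_increments_mono {a : ℝ} (ha : 1 ≤ a) (k : ℕ) :
    ((k + 1 : ℕ) : ℝ) ^ a - (k : ℝ) ^ a ≤ ((k + 2 : ℕ) : ℝ) ^ a - ((k + 1 : ℕ) : ℝ) ^ a := by
  have h := (convexOn_rpow ha).2 (x := (k : ℝ)) (y := ((k + 2 : ℕ) : ℝ))
    (Set.mem_Ici.2 k.cast_nonneg) (Set.mem_Ici.2 (Nat.cast_nonneg _))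
    (show (0 : ℝ) ≤ 1 / 2 by norm_num) (show (0 : ℝ) ≤ 1 / 2 by norm_num) (by norm_num)
  have e : (1 / 2 : ℝ) • (k : ℝ) + (1 / 2 : ℝ) • ((k + 2 : ℕ) : ℝ) = ((k + 1 : ℕ) : ℝ) := by
    simp only [smul_eq_mul]
    push_cast
    ring
  rw [e] at h
  simp only [smul_eq_mul] at h
  linarith

/-! ### Comparison with the previous ratio -/

theorem genBell_le {a : ℝ} (ha : 0 < a) :
    genBell a ≤ a ^ a * (Real.exp (-a) * (Real.exp (-1) * Real.exp (Real.exp 1))) := by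
  rw [genBell_eq_poissonMean]
  refine (le_abs_self _).trans ((abs_poissonMean_le (C := a ^ a * Real.exp (-a)) zero_le_one
    fun k => ?_).trans (le_of_eq ?_))
  · rw [abs_of_nonneg (by positivity)]
    exact natCast_rpow_le ha k
  · rw [one_mul]
    ring

theorem genBell_lt_previousRatio {a : ℝ} (ha : 1 ≤ a) : genBell a < previousRatio a := by
  have ha0 : 0 < a := by linarith
  have hlog : 1 < Real.log (a + 4) := by
    rw [Real.lt_log_iff_exp_lt (by linarith)]
    linarith [Real.exp_one_lt_d9]
  set t := previousTau a with ht
  -- As `t` is an integer above `2`, it is at least `3`, which exceeds the constant `2.72` below.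
  have htl : 2 * Real.log (a + 4) ≤ t := Nat.le_ceil _
  have ht3 : 3 ≤ t := by
    have h : 2 < t := lt_of_lt_of_le (by linarith) htl
    rw [ht, previousTau] at h ⊢
    exact_mod_cast (by exact_mod_cast h : 2 < ⌈2 * Real.log (a + 4)⌉₊)
  have hpow : a ≤ (2 : ℝ) ^ (t + 1) := by
    have h2 : a + 4 ≤ (2 : ℝ) ^ t := by
      rw [Real.rpow_def_of_pos two_pos]
      -- Here `2 log 2 > 1`, so `2 ^ t ≥ exp (log (a + 4))`.
      calc a + 4 = Real.exp (Real.log (a + 4)) := (Real.exp_log (by linarith)).symm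
        _ ≤ _ := Real.exp_le_exp.2 (by nlinarith [Real.log_two_gt_d9])
    rw [Real.rpow_add two_pos, Real.rpow_one]
    linarith
  have hbig : a ^ a ≤ (2 : ℝ) ^ (a * (t + 1)) := by
    rw [mul_comm, Real.rpow_mul two_pos.le]
    exact Real.rpow_le_rpow ha0.le hpow ha0.le
  -- The total exponent `e - 1 - a` is at most `e - 2 < 1`.
  have hexp : Real.exp (-a) * (Real.exp (-1) * Real.exp (Real.exp 1)) ≤ 2.72 := by
    rw [← Real.exp_add, ← Real.exp_add]
    calc _ ≤ Real.exp 1 := Real.exp_le_exp.2 (by linarith [Real.exp_one_lt_d9])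
      _ ≤ _ := by linarith [Real.exp_one_lt_d9]
  have hapos : 0 < a ^ a := by positivity
  have h1 : genBell a ≤ a ^ a * 2.72 :=
    (genBell_le ha0).trans (mul_le_mul_of_nonneg_left hexp hapos.le)
  have h3 : 3 * (2 : ℝ) ^ (a * (t + 1)) ≤ t * (2 : ℝ) ^ (a * (t + 1)) :=
    mul_le_mul_of_nonneg_right ht3 (by positivity)
  refine lt_of_lt_of_le ?_ (le_max_right _ _)
  linarith

/-! ### Walks and paths -/

namespace RoutingInstance

variable {n m r : ℕ}

theorem IsPath.nil (I : RoutingInstance n m r) (u : Fin n) : I.IsPath u u [] :=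
  ⟨rfl, by simp⟩

theorem IsPath.nodup {I : RoutingInstance n m r} {u v : Fin n} {p : List (Fin m)}
    (h : I.IsPath u v p) : p.Nodup :=
  List.Nodup.of_map _ (List.nodup_cons.1 h.2).2

theorem IsPath.length_lt {I : RoutingInstance n m r} {u v : Fin n} {p : List (Fin m)}
    (h : I.IsPath u v p) : p.length < n := by
  have := h.2.length_le_card
  simpa [Nat.succ_le_iff] using this

theorem IsWalk.ne_nil {I : RoutingInstance n m r} {u v : Fin n} {p : List (Fin m)}
    (h : I.IsWalk u p v) (huv : u ≠ v) : p ≠ [] := by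
  rintro rfl
  exact huv h

theorem IsWalk.concat {I : RoutingInstance n m r} {u v : Fin n} {p : List (Fin m)}
    (h : I.IsWalk u p v) {e : Fin m} (he : I.src e = v) : I.IsWalk u (p ++ [e]) (I.dst e) := by
  induction p generalizing u with
  | nil =>
    obtain rfl : u = v := h
    exact ⟨he, rfl⟩
  | cons e' p ih => exact ⟨h.1, ih h.2⟩

theorem IsPath.exists_suffix {I : RoutingInstance n m r} {u v x : Fin n} {p : List (Fin m)}
    (h : I.IsPath u v p) (hx : x ∈ u :: p.map I.dst) : ∃ q ⊆ p, I.IsPath x v q := by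
  induction p generalizing u with
  | nil =>
    obtain rfl : x = u := by simpa using hx
    exact ⟨[], by simp, h⟩
  | cons e p ih =>
    rcases List.mem_cons.1 hx with rfl | hx
    · exact ⟨_, List.Subset.refl _, h⟩
    · obtain ⟨q, hq, hq'⟩ := ih ⟨h.1.2, (List.nodup_cons.1 h.2).2⟩ hx
      exact ⟨q, List.Subset.trans hq (List.subset_cons_self _ _), hq'⟩

/-- If the new first node already lies on the path found for the rest, the suffix starting at that
node avoids the repetition. -/
theorem IsWalk.exists_isPath {I : RoutingInstance n m r} {u v : Fin n} {p : List (Fin m)}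
    (h : I.IsWalk u p v) : ∃ q ⊆ p, I.IsPath u v q := by
  induction p generalizing u with
  | nil => exact ⟨[], by simp, h, by simp⟩
  | cons e p ih =>
    obtain ⟨q, hq, hq'⟩ := ih h.2
    by_cases hu : u ∈ I.dst e :: q.map I.dst
    · obtain ⟨q', hq'', h'⟩ := hq'.exists_suffix hu
      exact ⟨q', List.Subset.trans (List.Subset.trans hq'' hq) (List.subset_cons_self _ _), h'⟩
    · exact ⟨e :: q, List.cons_subset_cons _ hq, ⟨h.1, hq'.1⟩, List.nodup_cons.2 ⟨hu, hq'.2⟩⟩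

theorem IsWalk.sum_potential {I : RoutingInstance n m r} {u v : Fin n} {p : List (Fin m)}
    (h : I.IsWalk u p v) (φ : Fin n → ℝ) :
    (p.map fun e => φ (I.src e) - φ (I.dst e)).sum = φ u - φ v := by
  induction p generalizing u with
  | nil =>
    obtain rfl : u = v := h
    simp
  | cons e p ih =>
    rw [List.map_cons, List.sum_cons, ih h.2, h.1]
    ring

theorem IsPath.dst_ne {I : RoutingInstance n m r} {u v : Fin n} {p : List (Fin m)}
    (h : I.IsPath u v p) {e : Fin m} (he : e ∈ p) : I.dst e ≠ u := fun hu =>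
  (List.nodup_cons.1 h.2).1 (hu ▸ List.mem_map_of_mem he)

theorem IsPath.src_ne {I : RoutingInstance n m r} {u v : Fin n} {p : List (Fin m)}
    (h : I.IsPath u v p) {e : Fin m} (he : e ∈ p) : I.src e ≠ v := by
  induction p generalizing u with
  | nil => simp at he
  | cons e' p ih =>
    have ht : I.IsPath (I.dst e') v p := ⟨h.1.2, (List.nodup_cons.1 h.2).2⟩
    rcases List.mem_cons.1 he with rfl | he
    · rw [h.1.1]
      rintro rfl
      have hv : ∀ {w x : Fin n} {q : List (Fin m)}, I.IsWalk w q x → x ∈ w :: q.map I.dst := by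
        intro w x q
        induction q generalizing w with
        | nil => rintro rfl; simp
        | cons e q ih => exact fun hq => List.mem_cons_of_mem _ (ih hq.2)
      exact (List.nodup_cons.1 h.2).1 (hv h.1.2)
    · exact ih ht he

/-! ### Flows tested against potentials -/

/-- `f` is a (signed) flow of value `v` from `a` to `b`, tested against node potentials. -/
def IsFlow (I : RoutingInstance n m r) (a b : Fin n) (v : ℝ) (f : Fin m → ℝ) : Prop :=
  ∀ φ : Fin n → ℝ, ∑ e, f e * (φ (I.src e) - φ (I.dst e)) = v * (φ a - φ b)

/-- The flow of value `z` along `p`. -/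
def pathFlow (p : List (Fin m)) (z : ℝ) : Fin m → ℝ := fun e => if e ∈ p then z else 0

theorem IsPath.isFlow {I : RoutingInstance n m r} {a b : Fin n} {p : List (Fin m)}
    (h : I.IsPath a b p) (z : ℝ) : I.IsFlow a b z (pathFlow p z) := by
  intro φ
  rw [← h.1.sum_potential φ, ← List.sum_toFinset _ h.nodup, Finset.mul_sum]
  simp only [pathFlow, ite_mul, zero_mul]
  rw [← Finset.sum_filter]
  refine Finset.sum_congr ?_ fun _ _ => rfl
  ext e
  simp

theorem IsFlow.zero (I : RoutingInstance n m r) (a b : Fin n) : I.IsFlow a b 0 0 := by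
  intro φ
  simp

theorem IsFlow.add {I : RoutingInstance n m r} {a b : Fin n} {v w : ℝ} {f g : Fin m → ℝ}
    (hf : I.IsFlow a b v f) (hg : I.IsFlow a b w g) : I.IsFlow a b (v + w) (f + g) := by
  intro φ
  simp only [Pi.add_apply, add_mul, Finset.sum_add_distrib]
  rw [hf φ, hg φ]

theorem IsFlow.sub {I : RoutingInstance n m r} {a b : Fin n} {v w : ℝ} {f g : Fin m → ℝ}
    (hf : I.IsFlow a b v f) (hg : I.IsFlow a b w g) : I.IsFlow a b (v - w) (f - g) := by
  intro φ
  simp only [Pi.sub_apply, sub_mul, Finset.sum_sub_distrib]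
  rw [hf φ, hg φ]

theorem subtractAlong_eq (f : Fin m → ℝ) (p : List (Fin m)) (z : ℝ) :
    subtractAlong f p z = f - pathFlow p z := by
  funext e
  simp only [subtractAlong, pathFlow, Pi.sub_apply]
  split_ifs <;> simp

/-- Summation by parts. It links the node constraints of the program with `IsFlow`, which is linear
in the flow and yields cut identities from indicator potentials. -/
theorem sum_mul_potential (I : RoutingInstance n m r) (f : Fin m → ℝ) (φ : Fin n → ℝ) :
    ∑ e, f e * (φ (I.src e) - φ (I.dst e)) = ∑ u, φ u * (I.outflow f u - I.inflow f u) := by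
  have key : ∀ g : Fin m → Fin n,
      ∑ u, φ u * ∑ e ∈ Finset.univ.filter (fun e => g e = u), f e = ∑ e, f e * φ (g e) := by
    intro g
    simp_rw [Finset.sum_filter, Finset.mul_sum]
    rw [Finset.sum_comm]
    refine Finset.sum_congr rfl fun e _ => ?_
    rw [Finset.sum_eq_single (g e)]
    · simp [mul_comm]
    · intro u _ hu
      simp [hu.symm]
    · simp
  simp_rw [mul_sub, Finset.sum_sub_distrib]
  rw [← key, ← key]
  rfl

theorem inflow_eq_zero {I : RoutingInstance n m r} {f : Fin m → ℝ} {u : Fin n}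
    (h : ∀ e, I.dst e = u → f e = 0) : I.inflow f u = 0 :=
  Finset.sum_eq_zero fun e he => h e (Finset.mem_filter.1 he).2

theorem outflow_eq_zero {I : RoutingInstance n m r} {f : Fin m → ℝ} {u : Fin n}
    (h : ∀ e, I.src e = u → f e = 0) : I.outflow f u = 0 :=
  Finset.sum_eq_zero fun e he => h e (Finset.mem_filter.1 he).2

theorem IsFlow.outflow_sub_inflow {I : RoutingInstance n m r} {a b : Fin n} {v : ℝ}
    {f : Fin m → ℝ} (h : I.IsFlow a b v f) (u : Fin n) :
    I.outflow f u - I.inflow f u = v * ((if a = u then 1 else 0) - (if b = u then 1 else 0)) := by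
  have := (sum_mul_potential I f fun w => if w = u then 1 else 0).symm.trans
    (h fun w => if w = u then 1 else 0)
  simpa using this

theorem Feasible.isFlow {I : RoutingInstance n m r} {y : Fin r → Fin m → ℝ} (h : I.Feasible y)
    (i : Fin r) : I.IsFlow (I.source i) (I.target i) 1 (y i) := by
  intro φ
  rw [sum_mul_potential, one_mul]
  have hst := I.source_ne_target i
  rw [Finset.sum_eq_add_of_mem (I.source i) (I.target i) (Finset.mem_univ _) (Finset.mem_univ _)
    hst fun u _ hu => by rw [h.conservation i u hu.1 hu.2, mul_zero],
    h.outflow_source, inflow_eq_zero (h.enter_source i), h.inflow_target,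
    outflow_eq_zero (h.leave_target i)]
  ring

theorem feasible_of_isFlow {I : RoutingInstance n m r} {y : Fin r → Fin m → ℝ}
    (hnn : ∀ i e, 0 ≤ y i e) (hf : ∀ i, I.IsFlow (I.source i) (I.target i) 1 (y i))
    (hs : ∀ i e, I.dst e = I.source i → y i e = 0)
    (ht : ∀ i e, I.src e = I.target i → y i e = 0) : I.Feasible y where
  nonneg := hnn
  conservation i u h1 h2 := by
    rw [(hf i).outflow_sub_inflow u]
    simp [h1.symm, h2.symm]
  outflow_source i := by
    have := (hf i).outflow_sub_inflow (I.source i)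
    rw [inflow_eq_zero (hs i)] at this
    simpa [(I.source_ne_target i).symm] using this
  inflow_target i := by
    have := (hf i).outflow_sub_inflow (I.target i)
    rw [outflow_eq_zero (ht i)] at this
    simpa [I.source_ne_target i] using this
  enter_source := hs
  leave_target := ht

theorem IsRouting.feasible {I : RoutingInstance n m r} {P : Fin r → List (Fin m)}
    (h : I.IsRouting P) : I.Feasible fun i => pathFlow (P i) 1 := by
  refine feasible_of_isFlow (fun i e => ?_) (fun i => (h i).isFlow 1) (fun i e he => ?_)
    fun i e he => ?_
  · simp only [pathFlow]
    split_ifs <;> norm_num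
  · exact if_neg fun hm => (h i).dst_ne hm he
  · exact if_neg fun hm => (h i).src_ne hm he

/-- A nonnegative flow without a path of positive edges has value zero. -/
theorem IsFlow.value_eq_zero {I : RoutingInstance n m r} {a b : Fin n} {v : ℝ} {f : Fin m → ℝ}
    (h : I.IsFlow a b v f) (hab : a ≠ b) (hnn : ∀ e, 0 ≤ f e) (ha : ∀ e, I.dst e = a → f e = 0)
    (hno : ¬ ∃ p, I.IsPath a b p ∧ ∀ e ∈ p, 0 < f e) : v = 0 := by
  classical
  refine le_antisymm ?_ ?_
  -- Let `S` be the set of nodes reachable from `a` on positive edges. No positive edge leaves `S`,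
  -- so its indicator as potential makes every term nonpositive.
  · let S : Fin n → Prop := fun w => ∃ p, I.IsWalk a p w ∧ ∀ e ∈ p, 0 < f e
    have hSa : S a := ⟨[], rfl, by simp⟩
    have hSb : ¬ S b := by
      rintro ⟨p, hp, hpos⟩
      obtain ⟨q, hq, hq'⟩ := hp.exists_isPath
      exact hno ⟨q, hq', fun e he => hpos e (hq he)⟩
    have := h fun w => if S w then 1 else 0
    simp only [hSa, hSb, if_true, if_false, sub_zero, mul_one] at this
    rw [← this]
    refine Finset.sum_nonpos fun e _ => ?_
    rcases (hnn e).eq_or_lt with he | he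
    · rw [← he, zero_mul]
    · refine mul_nonpos_of_nonneg_of_nonpos he.le ?_
      by_cases h1 : S (I.src e)
      · have h2 : S (I.dst e) := by
          obtain ⟨p, hp, hpos⟩ := h1
          refine ⟨p ++ [e], hp.concat rfl, fun e' he' => ?_⟩
          rcases List.mem_append.1 he' with he' | he'
          · exact hpos e' he'
          · rwa [List.mem_singleton.1 he']
        simp [h1, h2]
      · rw [if_neg h1]
        split_ifs <;> norm_num
  -- Conversely, nothing enters `a`, so the value is the outflow of `a`.
  · have := h.outflow_sub_inflow a
    rw [inflow_eq_zero ha] at this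
    have hout : 0 ≤ I.outflow f a := Finset.sum_nonneg fun e _ => hnn e
    simp only [if_true, hab.symm, if_false, sub_zero, mul_one] at this
    linarith

/-! ### Flow decomposition -/

theorem subtractAlong_nonneg {f : Fin m → ℝ} {p : List (Fin m)} {z : ℝ} (hnn : ∀ e, 0 ≤ f e)
    (hz : IsLeast (f '' {e | e ∈ p}) z) (e : Fin m) : 0 ≤ subtractAlong f p z e := by
  unfold subtractAlong
  split_ifs with he
  · exact sub_nonneg.2 (hz.2 ⟨e, he, rfl⟩)
  · exact hnn e

/-- The number of edges of positive value. -/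
noncomputable def positiveCount (f : Fin m → ℝ) : ℕ := (Finset.univ.filter fun e => 0 < f e).card

theorem positiveCount_le (f : Fin m → ℝ) : positiveCount f ≤ m :=
  (Finset.card_filter_le _ _).trans (by simp)

/-- An edge attaining the minimum drops to zero and no edge becomes positive; this bounds the number
of rounds. -/
theorem positiveCount_subtractAlong_lt {f : Fin m → ℝ} {p : List (Fin m)} {z : ℝ}
    (hpos : ∀ e ∈ p, 0 < f e) (hz : IsLeast (f '' {e | e ∈ p}) z) :
    positiveCount (subtractAlong f p z) < positiveCount f := by
  obtain ⟨⟨e, he, rfl⟩, -⟩ := hz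
  refine Finset.card_lt_card ((Finset.ssubset_iff_of_subset fun e' he' => ?_).2 ⟨e, ?_, ?_⟩)
  · have h := (Finset.mem_filter.1 he').2
    refine Finset.mem_filter.2 ⟨Finset.mem_univ _, ?_⟩
    unfold subtractAlong at h
    split_ifs at h with h'
    · exact hpos e' h'
    · exact h
  · exact Finset.mem_filter.2 ⟨Finset.mem_univ _, hpos e he⟩
  · have he' : e ∈ p := he
    rw [Finset.mem_filter, not_and, subtractAlong, if_pos he', sub_self]
    exact fun _ => lt_irrefl 0

/-- The flow along the listed paths. -/
def listFlow (l : List (List (Fin m) × ℝ)) (e : Fin m) : ℝ :=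
  (l.map fun q => pathFlow q.1 q.2 e).sum

theorem isFlow_listFlow {I : RoutingInstance n m r} {a b : Fin n} {l : List (List (Fin m) × ℝ)}
    (h : ∀ q ∈ l, I.IsPath a b q.1) : I.IsFlow a b (l.map Prod.snd).sum (listFlow l) := by
  induction l with
  | nil => exact IsFlow.zero I a b
  | cons q l ih =>
    have h1 := (h q List.mem_cons_self).isFlow q.2
    have h2 := ih fun q' hq' => h q' (List.mem_cons_of_mem _ hq')
    rw [List.map_cons, List.sum_cons]
    exact h1.add h2

namespace IsDecomposition

variable {I : RoutingInstance n m r} {a b : Fin n} {f : Fin m → ℝ} {l : List (List (Fin m) × ℝ)}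

theorem length_le (h : I.IsDecomposition a b f l) : l.length ≤ positiveCount f := by
  induction h with
  | done => simp
  | step f p z l hp hpos hz hl ih =>
    exact ih.trans_lt (positiveCount_subtractAlong_lt hpos hz)

theorem isPath_and_pos (h : I.IsDecomposition a b f l) :
    ∀ q ∈ l, I.IsPath a b q.1 ∧ 0 < q.2 := by
  induction h with
  | done => simp
  | step f p z l hp hpos hz hl ih =>
    intro q hq
    rcases List.mem_cons.1 hq with rfl | hq
    · obtain ⟨⟨e, he, rfl⟩, -⟩ := hz
      exact ⟨hp, hpos e he⟩
    · exact ih q hq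

/-- Only an inequality, since a circulation may be left over. -/
theorem listFlow_le (h : I.IsDecomposition a b f l) (hnn : ∀ e, 0 ≤ f e) (e : Fin m) :
    listFlow l e ≤ f e := by
  induction h with
  | done f => simpa [listFlow] using hnn e
  | step f p z l hp hpos hz hl ih =>
    have := ih (subtractAlong_nonneg hnn hz)
    rw [subtractAlong_eq] at this
    simp only [Pi.sub_apply] at this
    simp only [listFlow, List.map_cons, List.sum_cons] at this ⊢
    linarith

/-- Each round lowers the value of the flow by `z`, and the flow left at the end has value zero. -/
theorem sum_eq (h : I.IsDecomposition a b f l) (hab : a ≠ b) (hnn : ∀ e, 0 ≤ f e)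
    (ha : ∀ e, I.dst e = a → f e = 0) {v : ℝ} (hv : I.IsFlow a b v f) :
    (l.map Prod.snd).sum = v := by
  induction h generalizing v with
  | done f hno => simpa using (hv.value_eq_zero hab hnn ha hno).symm
  | step f p z l hp hpos hz hl ih =>
    have h1 := ih (subtractAlong_nonneg hnn hz) (fun e he => by
        unfold subtractAlong
        rw [if_neg fun hm => hp.dst_ne hm he]
        exact ha e he) (v := v - z) (by
        rw [subtractAlong_eq]
        exact hv.sub (hp.isFlow z))
    rw [List.map_cons, List.sum_cons, h1]
    ring

end IsDecomposition

end RoutingInstance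

/-! ### Correctness and step count of the program -/

theorem Timed.val_bind {β γ : Type} (x : Timed β) (f : β → Timed γ) :
    (x >>= f).val = (f x.val).val := rfl

theorem Timed.steps_bind {β γ : Type} (x : Timed β) (f : β → Timed γ) :
    (x >>= f).steps = x.steps + (f x.val).steps := rfl

theorem Timed.val_pure {β : Type} (x : β) : (pure x : Timed β).val = x := rfl

theorem Timed.steps_pure {β : Type} (x : β) : (pure x : Timed β).steps = 0 := rfl

theorem Timed.steps_charge (k : ℕ) : (Timed.charge k).steps = k := rfl

namespace RoutingInstance

variable {n m r : ℕ}

theorem relaxEdge_steps (I : RoutingInstance n m r) (f : Fin m → ℝ)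
    (L : Fin n → Option (List (Fin m))) (e : Fin m) : (I.relaxEdge f L e).steps = 1 := by
  unfold relaxEdge
  rw [Timed.steps_bind, Timed.steps_charge]
  split
  · split_ifs <;> rfl
  · rfl

theorem foldlM_relaxEdge_steps (I : RoutingInstance n m r) (f : Fin m → ℝ) (es : List (Fin m))
    (L : Fin n → Option (List (Fin m))) : (es.foldlM (I.relaxEdge f) L).steps = es.length := by
  induction es generalizing L with
  | nil => rfl
  | cons e es ih =>
    rw [List.foldlM_cons, Timed.steps_bind, relaxEdge_steps, ih, List.length_cons, add_comm]

theorem sweeps_steps (I : RoutingInstance n m r) (f : Fin m → ℝ) (k : ℕ)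
    (L : Fin n → Option (List (Fin m))) : (I.sweeps f k L).steps = k * m := by
  induction k generalizing L with
  | zero => simp [sweeps, Timed.steps_pure]
  | succ k ih =>
    rw [sweeps, Timed.steps_bind, foldlM_relaxEdge_steps, ih, List.length_finRange]
    ring

/-- The labels are paths from `a` on edges of positive value that run through labelled nodes. -/
def ValidLabels (I : RoutingInstance n m r) (a : Fin n) (f : Fin m → ℝ)
    (L : Fin n → Option (List (Fin m))) : Prop :=
  ∀ v p, L v = some p → I.IsPath a v p.reverse ∧ (∀ e ∈ p, 0 < f e) ∧
    ∀ w ∈ a :: p.map I.dst, (L w).isSome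

theorem relaxEdge_val (I : RoutingInstance n m r) (f : Fin m → ℝ)
    (L : Fin n → Option (List (Fin m))) (e : Fin m) :
    ((I.relaxEdge f L e).val = L ∧
      ((L (I.src e)).isSome → 0 < f e → (L (I.dst e)).isSome)) ∨
    ∃ p, L (I.src e) = some p ∧ L (I.dst e) = none ∧ 0 < f e ∧
      (I.relaxEdge f L e).val = Function.update L (I.dst e) (some (e :: p)) := by
  unfold relaxEdge
  rw [Timed.val_bind]
  split
  · rename_i p h1 h2
    split_ifs with h
    · exact Or.inr ⟨p, h1, h2, h, rfl⟩
    · exact Or.inl ⟨rfl, fun _ h' => absurd h' h⟩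
  · rename_i h
    refine Or.inl ⟨rfl, fun h1 _ => ?_⟩
    obtain ⟨p, hp⟩ := Option.isSome_iff_exists.1 h1
    by_contra h2
    exact h p hp (by simpa using h2)

theorem relaxEdge_isSome (I : RoutingInstance n m r) (f : Fin m → ℝ)
    {L : Fin n → Option (List (Fin m))} (e : Fin m) {w : Fin n} (hw : (L w).isSome) :
    ((I.relaxEdge f L e).val w).isSome := by
  rcases I.relaxEdge_val f L e with ⟨h, -⟩ | ⟨p, -, -, -, h⟩
  · rwa [h]
  · rw [h]
    by_cases hwe : w = I.dst e
    · simp [hwe]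
    · rwa [Function.update_of_ne hwe]

theorem relaxEdge_isSome_dst (I : RoutingInstance n m r) (f : Fin m → ℝ)
    {L : Fin n → Option (List (Fin m))} {e : Fin m} (hs : (L (I.src e)).isSome) (he : 0 < f e) :
    ((I.relaxEdge f L e).val (I.dst e)).isSome := by
  rcases I.relaxEdge_val f L e with ⟨h, h'⟩ | ⟨p, -, -, -, h⟩
  · rw [h]
    exact h' hs he
  · simp [h]

theorem ValidLabels.relaxEdge {I : RoutingInstance n m r} {a : Fin n} {f : Fin m → ℝ}
    {L : Fin n → Option (List (Fin m))} (hL : I.ValidLabels a f L) (e : Fin m) :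
    I.ValidLabels a f (I.relaxEdge f L e).val := by
  intro v q hq
  have hmono : ∀ w, (L w).isSome → ((I.relaxEdge f L e).val w).isSome := fun w =>
    I.relaxEdge_isSome f e
  rcases I.relaxEdge_val f L e with ⟨h, -⟩ | ⟨p, hp, hn, he, h⟩
  · rw [h] at hq ⊢
    exact hL v q hq
  · by_cases hv : v = I.dst e
    · have hv' : ((I.relaxEdge f L e).val (I.dst e)).isSome := by simp [h]
      subst hv
      rw [h, Function.update_self, Option.some.injEq] at hq
      subst hq
      obtain ⟨h1, h2, h3⟩ := hL _ _ hp
      -- All nodes of a recorded path are labelled and the head of `e` is not, so the extended path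
      -- stays simple.
      have hnot : I.dst e ∉ a :: p.map I.dst := fun hm => by simpa [hn] using h3 _ hm
      refine ⟨⟨?_, ?_⟩, ?_, ?_⟩
      · rw [List.reverse_cons]
        exact h1.1.concat rfl
      · rw [List.reverse_cons, List.map_append, ← List.cons_append]
        refine h1.2.append (by simp) ?_
        simpa using hnot
      · exact List.forall_mem_cons.2 ⟨he, h2⟩
      · intro w hw
        rcases List.mem_cons.1 hw with rfl | hw
        · exact hmono _ (h3 _ List.mem_cons_self)
        · rcases List.mem_cons.1 hw with rfl | hw
          · exact hv'
          · exact hmono _ (h3 _ (List.mem_cons_of_mem _ hw))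
    · rw [h, Function.update_of_ne hv] at hq
      obtain ⟨h1, h2, h3⟩ := hL v q hq
      exact ⟨h1, h2, fun w hw => hmono w (h3 w hw)⟩

theorem foldlM_relaxEdge (I : RoutingInstance n m r) {a : Fin n} (f : Fin m → ℝ)
    (es : List (Fin m)) {L : Fin n → Option (List (Fin m))} (hL : I.ValidLabels a f L) :
    I.ValidLabels a f (es.foldlM (I.relaxEdge f) L).val ∧
    (∀ w, (L w).isSome → ((es.foldlM (I.relaxEdge f) L).val w).isSome) ∧
    ∀ e ∈ es, (L (I.src e)).isSome → 0 < f e →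
      ((es.foldlM (I.relaxEdge f) L).val (I.dst e)).isSome := by
  induction es generalizing L with
  | nil => exact ⟨hL, fun w hw => hw, by simp⟩
  | cons e es ih =>
    rw [List.foldlM_cons, Timed.val_bind]
    obtain ⟨h1, h2, h3⟩ := ih (hL.relaxEdge e)
    refine ⟨h1, fun w hw => h2 w (I.relaxEdge_isSome f e hw), fun e' he' hs hpos => ?_⟩
    rcases List.mem_cons.1 he' with rfl | he'
    · exact h2 _ (I.relaxEdge_isSome_dst f hs hpos)
    · exact h3 e' he' (I.relaxEdge_isSome f e hs) hpos

/-- Each pass relaxes every edge, so it covers at least the first edge of any positive walk from a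
labelled node; induction handles the rest. -/
theorem sweeps_spec (I : RoutingInstance n m r) {a : Fin n} (f : Fin m → ℝ) (k : ℕ)
    {L : Fin n → Option (List (Fin m))} (hL : I.ValidLabels a f L) :
    I.ValidLabels a f (I.sweeps f k L).val ∧
    ∀ u v p, I.IsWalk u p v → (∀ e ∈ p, 0 < f e) → p.length ≤ k → (L u).isSome →
      ((I.sweeps f k L).val v).isSome := by
  induction k generalizing L with
  | zero =>
    refine ⟨hL, fun u v p hp _ hk hu => ?_⟩
    obtain rfl := List.length_eq_zero_iff.1 (Nat.le_zero.1 hk)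
    obtain rfl : u = v := hp
    exact hu
  | succ k ih =>
    rw [sweeps, Timed.val_bind]
    obtain ⟨h1, h2, h3⟩ := I.foldlM_relaxEdge f (List.finRange m) hL
    refine ⟨(ih h1).1, fun u v p hp hpos hk hu => ?_⟩
    cases p with
    | nil => exact (ih h1).2 u v [] hp (by simp) (Nat.zero_le _) (h2 u hu)
    | cons e p =>
      refine (ih h1).2 _ v p hp.2 (fun e' he' => hpos e' (List.mem_cons_of_mem _ he'))
        (Nat.le_of_succ_le_succ hk) ?_
      exact h3 e (List.mem_finRange e) (by rwa [hp.1]) (hpos e List.mem_cons_self)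

theorem findPath_spec (I : RoutingInstance n m r) (a b : Fin n) (f : Fin m → ℝ) :
    ((I.findPath a b f).val = none → ¬ ∃ p, I.IsPath a b p ∧ ∀ e ∈ p, 0 < f e) ∧
    (∀ p, (I.findPath a b f).val = some p → I.IsPath a b p ∧ ∀ e ∈ p, 0 < f e) ∧
    (I.findPath a b f).steps ≤ n * m + 2 * n + 1 := by
  have hinit : I.ValidLabels a f fun v => if v = a then some [] else none := by
    intro v p hp
    by_cases hv : v = a
    · subst hv
      obtain rfl : [] = p := by simpa using hp
      exact ⟨IsPath.nil I v, by simp, by simp⟩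
    · simp [hv] at hp
  obtain ⟨hval, hcomp⟩ := I.sweeps_spec f n hinit
  have hst := I.sweeps_steps f n (fun v => if v = a then some [] else none)
  unfold findPath
  simp only [Timed.val_bind, Timed.steps_bind, Timed.steps_charge, hst]
  split
  · rename_i hb
    refine ⟨fun _ => ?_, fun p hp => by simp [Timed.val_pure] at hp, ?_⟩
    · rintro ⟨p, hp, hpos⟩
      -- A path has fewer than `n` edges, so `n` passes suffice.
      have := hcomp a b p hp.1 hpos hp.length_lt.le (by simp)
      simp [hb] at this
    · rw [Timed.steps_pure]
      omega
  · rename_i p hb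
    obtain ⟨h1, h2, -⟩ := hval b p hb
    refine ⟨fun h => by simp [Timed.val_bind, Timed.val_pure] at h, fun q hq => ?_, ?_⟩
    · obtain rfl : p.reverse = q := by simpa [Timed.val_bind, Timed.val_pure] using hq
      exact ⟨h1, fun e he => h2 e (List.mem_reverse.1 he)⟩
    · have := h1.length_lt
      rw [List.length_reverse] at this
      simp only [Timed.steps_bind, Timed.steps_charge, Timed.steps_pure]
      omega

theorem isLeast_min? {f : Fin m → ℝ} {p : List (Fin m)} (hp : p ≠ []) :
    IsLeast (f '' {e | e ∈ p}) ((p.map f).min?.getD 0) := by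
  obtain ⟨z, hz⟩ := Option.isSome_iff_exists.1
    (List.isSome_min?_of_ne_nil (l := p.map f) (by simpa using hp))
  rw [hz, Option.getD_some]
  obtain ⟨h1, h2⟩ := List.min?_eq_some_iff.1 hz
  refine ⟨by simpa using h1, ?_⟩
  rintro _ ⟨e, he, rfl⟩
  exact h2 _ (List.mem_map_of_mem he)

/-- The strict bound leaves one extra round in which the search finds no path; hence the `m + 1`
rounds allotted in `pathTable`. -/
theorem decompose_spec (I : RoutingInstance n m r) {a b : Fin n} (hab : a ≠ b) (k : ℕ)
    (f : Fin m → ℝ) :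
    (positiveCount f < k → I.IsDecomposition a b f (I.decompose a b k f).val) ∧
    (I.decompose a b k f).steps ≤ k * (n * m + 4 * n + 2) := by
  induction k generalizing f with
  | zero =>
    exact ⟨fun h => absurd h (Nat.not_lt_zero _),
      le_of_eq (by simp [decompose, Timed.steps_pure])⟩
  | succ k ih =>
    obtain ⟨h1, h2, h3⟩ := I.findPath_spec a b f
    rw [decompose, Timed.val_bind, Timed.steps_bind, add_mul, one_mul]
    split
    · rename_i hq
      refine ⟨fun _ => IsDecomposition.done f (h1 hq), ?_⟩
      rw [Timed.steps_pure]
      omega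
    · rename_i p hq
      obtain ⟨hp, hpos⟩ := h2 p hq
      -- A path between distinct nodes is nonempty, so the default value `0` is never used.
      have hz := isLeast_min? (f := f) (hp.1.ne_nil hab)
      obtain ⟨ih1, ih2⟩ := ih (subtractAlong f p ((p.map f).min?.getD 0))
      refine ⟨fun hk => ?_, ?_⟩
      · exact IsDecomposition.step f p _ _ hp hpos hz
          (ih1 (by have := positiveCount_subtractAlong_lt hpos hz; omega))
      · have := hp.length_lt
        simp only [Timed.steps_bind, Timed.steps_charge, Timed.steps_pure]
        omega

theorem pathTable_isDecomposition (I : RoutingInstance n m r) (y : Fin r → Fin m → ℝ)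
    (i : Fin r) :
    I.IsDecomposition (I.source i) (I.target i) (y i) (I.pathTable y i).val :=
  (I.decompose_spec (I.source_ne_target i) (m + 1) (y i)).1
    (Nat.lt_succ_of_le (positiveCount_le _))

theorem roundingSteps_le (I : RoutingInstance n m r) (y : Fin r → Fin m → ℝ) :
    I.roundingSteps y ≤ 8 * (n + m + r + 1) ^ 4 := by
  have hi : ∀ i ∈ (Finset.univ : Finset (Fin r)),
      (I.pathTable y i).steps + ((I.pathTable y i).val.length + 1) ≤
        (m + 1) * (n * m + 4 * n + 2) + (m + 1) := fun i _ =>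
    add_le_add (I.decompose_spec (I.source_ne_target i) (m + 1) (y i)).2
      (Nat.succ_le_succ ((I.pathTable_isDecomposition y i).length_le.trans (positiveCount_le _)))
  refine (Finset.sum_le_card_nsmul _ _ _ hi).trans ?_
  rw [Finset.card_univ, Fintype.card_fin, smul_eq_mul]
  set N := n + m + r + 1
  have hn : n ≤ N := by omega
  have hm : m + 1 ≤ N := by omega
  have hr : r ≤ N := by omega
  have hN : 1 ≤ N := by omega
  calc r * ((m + 1) * (n * m + 4 * n + 2) + (m + 1))
      ≤ N * (N * (N * N + 4 * (N * N) + 2 * (N * N)) + N * (N * N)) := by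
        refine Nat.mul_le_mul hr (add_le_add (Nat.mul_le_mul hm ?_) ?_)
        · refine add_le_add (add_le_add (Nat.mul_le_mul hn (by omega)) ?_) ?_
          · exact Nat.mul_le_mul le_rfl (hn.trans (Nat.le_mul_of_pos_right _ hN))
          · exact Nat.le_mul_of_pos_right _ (Nat.mul_pos hN hN)
        · exact hm.trans (Nat.le_mul_of_pos_right _ (Nat.mul_pos hN hN))
    _ = 8 * N ^ 4 := by ring

/-! ### Existence of an optimal solution -/

theorem objective_coeff_nonneg (I : RoutingInstance n m r) (e : Fin m) :
    0 ≤ I.c e * (I.d : ℝ) ^ I.α e :=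
  mul_nonneg (I.c_nonneg e) (Real.rpow_nonneg (Nat.cast_nonneg _) _)

theorem objective_mono (I : RoutingInstance n m r) {y y' : Fin r → Fin m → ℝ}
    (h0 : ∀ i e, 0 ≤ y i e) (h : ∀ i e, y i e ≤ y' i e) : I.objective y ≤ I.objective y' := by
  refine Finset.sum_le_sum fun e _ => mul_le_mul_of_nonneg_left ?_ (I.objective_coeff_nonneg e)
  have hs : ∑ i, y i e ≤ ∑ i, y' i e := Finset.sum_le_sum fun i _ => h i e
  exact max_le_max hs (Real.rpow_le_rpow (Finset.sum_nonneg fun i _ => h0 i e) hs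
    (zero_le_one.trans (I.one_le_α e)))

theorem continuous_objective (I : RoutingInstance n m r) : Continuous I.objective := by
  have h : ∀ e, Continuous fun y : Fin r → Fin m → ℝ => ∑ i, y i e := fun e => by fun_prop
  refine continuous_finsetSum _ fun e _ => continuous_const.mul ((h e).max ?_)
  exact (h e).rpow_const fun _ => Or.inr (zero_le_one.trans (I.one_le_α e))

/-- Through potentials, feasibility becomes a family of linear equations and inequalities in `y`. -/
theorem isClosed_feasible (I : RoutingInstance n m r) : IsClosed {y | I.Feasible y} := by
  have h : {y | I.Feasible y} = {y | (∀ i e, 0 ≤ y i e) ∧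
      (∀ i, ∀ φ : Fin n → ℝ, ∑ e, y i e * (φ (I.src e) - φ (I.dst e)) =
        1 * (φ (I.source i) - φ (I.target i))) ∧
      (∀ i e, I.dst e = I.source i → y i e = 0) ∧ ∀ i e, I.src e = I.target i → y i e = 0} := by
    ext y
    exact ⟨fun h => ⟨h.nonneg, h.isFlow, h.enter_source, h.leave_target⟩,
      fun h => feasible_of_isFlow h.1 h.2.1 h.2.2.1 h.2.2.2⟩
  rw [h]
  simp only [Set.ofPred_and, Set.ofPred_forall]
  refine IsClosed.inter ?_ (IsClosed.inter ?_ (IsClosed.inter ?_ ?_))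
  · exact isClosed_iInter fun i => isClosed_iInter fun e =>
      isClosed_le continuous_const (by fun_prop)
  · exact isClosed_iInter fun i => isClosed_iInter fun φ =>
      isClosed_eq (by fun_prop) continuous_const
  all_goals
    exact isClosed_iInter fun i => isClosed_iInter fun e => isClosed_iInter fun _ =>
      isClosed_eq (by fun_prop) continuous_const

/-- Removing the circulation that a flow decomposition leaves over gives a feasible solution with
values at most one. -/
theorem Feasible.exists_le_one {I : RoutingInstance n m r} {y : Fin r → Fin m → ℝ}
    (h : I.Feasible y) :
    ∃ y', I.Feasible y' ∧ (∀ i e, y' i e ≤ y i e) ∧ ∀ i e, y' i e ≤ 1 := by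
  have hd := I.pathTable_isDecomposition y
  have hle := fun i => (hd i).listFlow_le (h.nonneg i)
  have hsum := fun i => (hd i).sum_eq (I.source_ne_target i) (h.nonneg i) (h.enter_source i)
    (h.isFlow i)
  have hnn : ∀ i e, 0 ≤ listFlow (I.pathTable y i).val e := by
    intro i e
    refine List.sum_nonneg fun x hx => ?_
    obtain ⟨q, hq, rfl⟩ := List.mem_map.1 hx
    unfold pathFlow
    split_ifs
    · exact ((hd i).isPath_and_pos q hq).2.le
    · exact le_rfl
  refine ⟨fun i => listFlow (I.pathTable y i).val,
    feasible_of_isFlow hnn (fun i => ?_) (fun i e he => ?_) (fun i e he => ?_), hle, fun i e => ?_⟩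
  · rw [← hsum i]
    exact isFlow_listFlow fun q hq => ((hd i).isPath_and_pos q hq).1
  · exact le_antisymm ((hle i e).trans (h.enter_source i e he).le) (hnn i e)
  · exact le_antisymm ((hle i e).trans (h.leave_target i e he).le) (hnn i e)
  · rw [← hsum i]
    refine List.sum_le_sum fun q hq => ?_
    unfold pathFlow
    split_ifs
    · exact le_rfl
    · exact ((hd i).isPath_and_pos q hq).2.le

/-- Circulations can make the feasible set unbounded. Minimizing over its compact part in `[0, 1]`
suffices, since every feasible point dominates one there. -/
theorem exists_isOptimal (I : RoutingInstance n m r)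
    (hI : ∀ i, ∃ p, I.IsPath (I.source i) (I.target i) p) : ∃ y, I.IsOptimal y := by
  have hcomp : IsCompact ({y | I.Feasible y} ∩ Set.Icc (0 : Fin r → Fin m → ℝ) 1) :=
    isCompact_Icc.inter_left I.isClosed_feasible
  choose P hP using hI
  obtain ⟨y₀, hy₀, -, hy₀1⟩ := IsRouting.feasible hP |>.exists_le_one
  obtain ⟨y, hy, hmin⟩ := hcomp.exists_isMinOn ⟨y₀, hy₀, fun i e => hy₀.nonneg i e, hy₀1⟩
    I.continuous_objective.continuousOn
  refine ⟨y, hy.1, fun y' hy' => ?_⟩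
  obtain ⟨z, hz, hzy, hz1⟩ := hy'.exists_le_one
  exact (hmin ⟨hz, fun i e => hz.nonneg i e, hz1⟩).trans (I.objective_mono hz.nonneg hzy)

/-! ### Expected energy of the rounding -/

theorem cost_eq (I : RoutingInstance n m r) (P : Fin r → List (Fin m)) :
    I.cost P = ∑ e, I.c e * (I.d : ℝ) ^ I.α e *
      ((∑ i, if e ∈ P i then 1 else 0 : ℕ) : ℝ) ^ I.α e := by
  refine Finset.sum_congr rfl fun e _ => ?_
  rw [load, Nat.cast_mul, Real.mul_rpow (Nat.cast_nonneg _) (Nat.cast_nonneg _),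
    Finset.card_filter, mul_assoc]

/-- The program is a relaxation because the maximum in the objective is the power at natural
numbers. -/
theorem objective_pathFlow (I : RoutingInstance n m r) (P : Fin r → List (Fin m)) :
    I.objective (fun i => pathFlow (P i) 1) = I.cost P := by
  rw [cost_eq]
  refine Finset.sum_congr rfl fun e _ => ?_
  congr 1
  have : ∑ i, pathFlow (P i) 1 e = ((∑ i, if e ∈ P i then 1 else 0 : ℕ) : ℝ) := by
    push_cast
    rfl
  rw [this]
  generalize (∑ i, if e ∈ P i then 1 else 0 : ℕ) = N
  refine max_eq_right ?_
  rcases Nat.eq_zero_or_pos N with rfl | hN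
  · rw [Nat.cast_zero]
    exact Real.rpow_nonneg le_rfl _
  · exact Real.self_le_rpow_of_one_le (by exact_mod_cast hN) (I.one_le_α e)

theorem genBell_α_le (I : RoutingInstance n m r) (e : Fin m) :
    genBell (I.α e) ≤ genBell I.alphaMax :=
  genBell_mono (by linarith [I.one_le_α e]) (le_ciSup (Set.finite_range I.α).bddAbove e)

theorem expectedCost_le (I : RoutingInstance n m r) {y : Fin r → Fin m → ℝ}
    {l : Fin r → List (List (Fin m) × ℝ)} (hpos : ∀ i, ∀ q ∈ l i, 0 ≤ q.2)
    (hsum : ∀ i, ((l i).map Prod.snd).sum = 1) (hle : ∀ i e, listFlow (l i) e ≤ y i e) :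
    I.expectedCost l ≤ genBell I.alphaMax * I.objective y := by
  have hv : ∀ i (x : Fin (l i).length), 0 ≤ ((l i).get x).2 := fun i x =>
    hpos i _ (List.get_mem _ _)
  have hflow : ∀ i e, ∑ x : Fin (l i).length,
      ((l i).get x).2 * ((if e ∈ ((l i).get x).1 then 1 else 0 : ℕ) : ℝ) = listFlow (l i) e := by
    intro i e
    rw [listFlow, ← Fin.sum_univ_fun_getElem]
    refine Finset.sum_congr rfl fun x _ => ?_
    simp [pathFlow]
  have key : ∀ e, ∑ k : (i : Fin r) → Fin (l i).length, (∏ i, ((l i).get (k i)).2) *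
      ((∑ i, if e ∈ ((l i).get (k i)).1 then 1 else 0 : ℕ) : ℝ) ^ I.α e ≤
      genBell I.alphaMax * max (∑ i, y i e) ((∑ i, y i e) ^ I.α e) := by
    intro e
    have hα := I.one_le_α e
    -- Demand `i` contributes the indicator that its drawn path uses `e`, whose mean is `listFlow (l
    -- i) e`.
    have h1 := sum_bernoulli_le_poissonMean r (fun i => Fin (l i).length)
      (fun i x => ((l i).get x).2) (fun i x => if e ∈ ((l i).get x).1 then 1 else 0) hv
      (fun i => by rw [← hsum i, ← Fin.sum_univ_fun_getElem]; rfl)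
      (fun i x => by split_ifs <;> simp)
      (expBounded_rpow (a := I.α e) (by linarith)) (rpow_increments_mono hα)
    have h0 : 0 ≤ ∑ i, listFlow (l i) e := by
      simp_rw [← hflow]
      exact Finset.sum_nonneg fun i _ => Finset.sum_nonneg fun x _ =>
        mul_nonneg (hv i x) (Nat.cast_nonneg _)
    simp_rw [hflow] at h1
    have hs : ∑ i, listFlow (l i) e ≤ ∑ i, y i e := Finset.sum_le_sum fun i _ => hle i e
    refine h1.trans ((poissonMean_rpow_le hα h0).trans ?_)
    exact mul_le_mul (I.genBell_α_le e)
      (max_le_max hs (Real.rpow_le_rpow h0 hs (by linarith))) (h0.trans (le_max_left _ _))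
      (genBell_nonneg _)
  calc I.expectedCost l
      = ∑ e, I.c e * (I.d : ℝ) ^ I.α e * ∑ k : (i : Fin r) → Fin (l i).length,
          (∏ i, ((l i).get (k i)).2) *
            ((∑ i, if e ∈ ((l i).get (k i)).1 then 1 else 0 : ℕ) : ℝ) ^ I.α e := by
        simp_rw [expectedCost, cost_eq, Finset.mul_sum]
        rw [Finset.sum_comm]
        exact Finset.sum_congr rfl fun e _ => Finset.sum_congr rfl fun k _ => by ring
    _ ≤ ∑ e, I.c e * (I.d : ℝ) ^ I.α e *
          (genBell I.alphaMax * max (∑ i, y i e) ((∑ i, y i e) ^ I.α e)) :=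
        Finset.sum_le_sum fun e _ => mul_le_mul_of_nonneg_left (key e) (I.objective_coeff_nonneg e)
    _ = genBell I.alphaMax * I.objective y := by
        rw [objective, Finset.mul_sum]
        exact Finset.sum_congr rfl fun e _ => by ring

end RoutingInstance

theorem mainTheorem5 :
    -- solving the relaxed program and rounding any optimal solution is a `B̃_{α_max}`-approximation
    (∀ (n m r : ℕ) (I : RoutingInstance n m r),
      (∀ i, ∃ p, I.IsPath (I.source i) (I.target i) p) →
      (∃ y, I.IsOptimal y) ∧
      ∀ y, I.IsOptimal y →
        ∀ l : Fin r → List (List (Fin m) × ℝ),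
          (∀ i, I.IsDecomposition (I.source i) (I.target i) (y i) (l i)) →
          (∀ i, (l i).length ≤ m ∧
            (∀ q ∈ l i, I.IsPath (I.source i) (I.target i) q.1 ∧ 0 < q.2) ∧
            ((l i).map Prod.snd).sum = 1) ∧
          ∀ P, I.IsRouting P → I.expectedCost l ≤ genBell I.alphaMax * I.cost P) ∧
    -- the rounding is carried out in polynomial time
    (∃ C k : ℕ, ∀ (n m r : ℕ) (I : RoutingInstance n m r) (y : Fin r → Fin m → ℝ),
      I.Feasible y →
        (∀ i, I.IsDecomposition (I.source i) (I.target i) (y i) (I.pathTable y i).val) ∧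
        I.roundingSteps y ≤ C * (n + m + r + 1) ^ k) ∧
    -- the ratio is better than the one known before
    (∀ a : ℝ, 1 ≤ a → genBell a < previousRatio a) := by
  refine ⟨fun n m r I hI => ⟨I.exists_isOptimal hI, fun y hy l hl => ?_⟩, ⟨8, 4, ?_⟩,
    fun a ha => genBell_lt_previousRatio ha⟩
  · have hF := hy.1
    have hsum := fun i => (hl i).sum_eq (I.source_ne_target i) (hF.nonneg i) (hF.enter_source i)
      (hF.isFlow i)
    refine ⟨fun i => ⟨(hl i).length_le.trans (RoutingInstance.positiveCount_le _),
      (hl i).isPath_and_pos, hsum i⟩, fun P hP => ?_⟩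
    -- The left-over circulation is harmless: recorded flows are dominated by `y`, and optimality
    -- compares `y` with the 0/1 flow of `P`.
    refine (I.expectedCost_le (fun i q hq => ((hl i).isPath_and_pos q hq).2.le) hsum
      fun i => (hl i).listFlow_le (hF.nonneg i)).trans ?_
    rw [← I.objective_pathFlow P]
    exact mul_le_mul_of_nonneg_left (hy.2 _ hP.feasible) (genBell_nonneg _)
  · exact fun n m r I y _ => ⟨I.pathTable_isDecomposition y, I.roundingSteps_le y⟩
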